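/- Let $\Phi=(\varphi_n)_{n\ge 0}$ be a sequence of functions $\varphi_n:\mathbb{R}\to\mathbb{C}$. Then the $\varphi_n$ are real-valued, belong to $L^2(\mathbb{R})$, are differentiable and satisfy \[ \varphi_0'=b_0\varphi_1,\qquad \varphi_n'=-b_{n-1}\varphi_{n-1}+b_n\varphi_{n+1}\quad(n\ge 1) \] for some sequence of real numbers $b_n>0$, if and only if there are a measure $\mu$, polynomials $p_n$, a function $g$ and phases $\theta_n$ such that \[ \varphi_n(x)=\frac{e^{i\theta_n}}{\sqrt{2\pi}}\int_{-\infty}^{\infty}e^{ix\xi}\,p_n(\xi)\,g(\xi)\,d\xi\qquad(n\ge 0,\ x\in\mathbb{R}), \] where \begin{itemize} \item $\mu$ is a Borel probability measure on $\mathbb{R}$ with all moments finite and with infinitely many points of increase, and $(p_n)_{n\ge 0}$ is the orthonormal polynomial system for $\mu$: $p_n$ is a real polynomial of degree $n$ with positive leading coefficient and $\int p_mp_n\,d\mu=\delta_{mn}$; \item $g:\mathbb{R}\to\mathbb{C}$ is in $L^2(\mathbb{R})$ and decays superalgebraically in the $L^2$ sense: for every $n\ge 0$, $\int_{|\xi|>R}|\xi^n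 g(\xi)|^2\,d\xi\to 0$ as $R\to\infty$; \item $\theta_n\in[0,2\pi)$ for all $n$; \end{itemize} and in addition \begin{enumerate} \item $\mu$ is symmetric, i.e. $d\mu(-\xi)=d\mu(\xi)$; \item $g$ has even real part and odd imaginary part (almost everywhere); \item $e^{i\theta_n}=i^n$ for all $n$, i.e. $\theta_n\equiv n\pi/2 \pmod{2\pi}$. \end{enumerate} -/

import Mathlib

open MeasureTheory Filter Topology

/-- `μ` has infinitely many points of increase: points `x` such that every open interval
centred at `x` has positive mass. -/
def HasInfinitelyManyPointsOfIncrease (μ : Measure ℝ) : Prop :=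
  {x : ℝ | ∀ ε : ℝ, 0 < ε → 0 < μ (Set.Ioo (x - ε) (x + ε))}.Infinite

/-- `p 0, p 1, p 2, …` is the orthonormal polynomial system with respect to `μ`: `p n` is a real
polynomial of degree `n` with positive leading coefficient, and `∫ p m * p n dμ` is `1` if
`m = n` and `0` otherwise. -/
structure IsOrthonormalPolynomialSystem (μ : Measure ℝ) (p : ℕ → Polynomial ℝ) : Prop where
  natDegree_eq : ∀ n, (p n).natDegree = n
  leadingCoeff_pos : ∀ n, 0 < (p n).leadingCoeff
  orthonormal : ∀ m n, ∫ ξ, (p m).eval ξ * (p n).eval ξ ∂μ = if m = n then 1 else 0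

/-- `g` decays faster than every power at infinity, in the mean square sense: for every `n`,
the `L²` norm of `ξ ^ n * g ξ` over `|ξ| > R` tends to `0` as `R → ∞`. -/
def HasSuperalgebraicDecay (g : ℝ → ℂ) : Prop :=
  ∀ n : ℕ, Tendsto
    (fun R : ℝ => eLpNorm (fun ξ : ℝ => (ξ : ℂ) ^ n * g ξ) 2
      (volume.restrict {ξ : ℝ | R < |ξ|})) atTop (𝓝 0)

/-- The sequence `φ` is represented by the measure `μ`, the orthonormal polynomials `p`, the
function `g` and the phases `θ`. -/
structure IsFourierRepresentation (φ : ℕ → ℝ → ℂ) (μ : Measure ℝ) (p : ℕ → Polynomial ℝ)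
    (g : ℝ → ℂ) (θ : ℕ → ℝ) : Prop where
  isProbabilityMeasure : IsProbabilityMeasure μ
  moments_finite : ∀ n : ℕ, Integrable (fun ξ : ℝ => ξ ^ n) μ
  pointsOfIncrease : HasInfinitelyManyPointsOfIncrease μ
  orthonormal : IsOrthonormalPolynomialSystem μ p
  memLp : MemLp g 2 volume
  decay : HasSuperalgebraicDecay g
  phase_mem : ∀ n, θ n ∈ Set.Ico 0 (2 * Real.pi)
  eq_integral : ∀ n x, φ n x =
    Complex.exp (Complex.I * (θ n : ℂ)) / ((Real.sqrt (2 * Real.pi) : ℝ) : ℂ) *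
      ∫ ξ : ℝ, Complex.exp (Complex.I * (x : ℂ) * (ξ : ℂ)) * (((p n).eval ξ : ℝ) : ℂ) * g ξ

/-- The differential recurrence `φ₀' = b₀ φ₁`, `φₙ' = -bₙ₋₁ φₙ₋₁ + bₙ φₙ₊₁` for `n ≥ 1`
(written with `n + 1` in place of `n`). -/
structure SatisfiesSkewRecurrence (φ : ℕ → ℝ → ℂ) (b : ℕ → ℝ) : Prop where
  zero : ∀ x, HasDerivAt (φ 0) ((b 0 : ℂ) * φ 1 x) x
  succ : ∀ n x, HasDerivAt (φ (n + 1)) (-(b n : ℂ) * φ n x + (b (n + 1) : ℂ) * φ (n + 2) x) x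

/-! Differentiation in `x` is multiplication by `iξ` on the Fourier side. With the factors `iⁿ` in
front, the skew recurrence for `φ` is therefore the image of the symmetric recurrence `ξ pₙ = bₙ₋₁
pₙ₋₁ + bₙ pₙ₊₁` (`SatisfiesThreeTermRecurrence.satisfiesSkewRecurrence`). Its zero diagonal
corresponds to symmetry of `μ`, and `bₙ > 0` to positive leading coefficients
(`exists_satisfiesThreeTermRecurrence`). Conjugation reflects `ξ`: the parity `(-1)ⁿ` of `pₙ`
cancels the sign from conjugating `iⁿ`, so reality of `φₙ` follows from `conj (g (-ξ)) = g ξ`. This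
settles the passage from a representation to the recurrence.

Conversely, `b` generates the `pₙ`, and Favard's theorem (`exists_symmetric_orthonormal_measure`)
supplies `μ` as a weak limit of spectral measures of truncated Jacobi matrices, whose moments
stabilise. The function `g` is a rescaled Fourier transform of `φ₀` alone. The recurrence keeps all
derivatives in `L²`, so every power of `ξ` times this transform is in `L²`
(`SatisfiesSkewRecurrence.memLp_pow_mul_fourier`). The system built from `p` and `g` then solves the
same recurrence with the same first function, hence equals `φ` (`SatisfiesSkewRecurrence.unique`).
Reality of `φ₀` and injectivity of the `L²` transform give the symmetry of `g`. -/

open scoped FourierTransform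

/-! ### Truncation, tightness and limits of moments -/

lemma abs_sub_clamp_le {M : ℝ} (hM : 0 < M) (t : ℝ) :
    |t - max (-M) (min M t)| ≤ t ^ 2 / M := by
  rw [le_div_iff₀ hM]
  rcases le_total t M with h1 | h1
  · rw [min_eq_right h1]
    rcases le_total (-M) t with h2 | h2
    · rw [max_eq_right h2]; simp; positivity
    · rw [max_eq_left h2, abs_of_nonpos (by linarith)]; nlinarith
  · rw [min_eq_left h1, max_eq_right (by linarith), abs_of_nonneg (by linarith)]; nlinarith

lemma abs_clamp_le {M : ℝ} (hM : 0 < M) (t : ℝ) : |max (-M) (min M t)| ≤ M := by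
  rw [abs_le]
  exact ⟨le_max_left _ _, max_le (by linarith) (min_le_left _ _)⟩

/-- Truncating a continuous function at height `M` changes its mean by at most the second
moment divided by `M`. -/
lemma abs_integral_sub_integral_clamp_le (μ : Measure ℝ) [IsProbabilityMeasure μ] {f : ℝ → ℝ}
    (hf : Continuous f) (hi : Integrable f μ) (hi2 : Integrable (fun ξ => f ξ ^ 2) μ)
    {M : ℝ} (hM : 0 < M) :
    |∫ ξ, f ξ ∂μ - ∫ ξ, max (-M) (min M (f ξ)) ∂μ| ≤ (∫ ξ, f ξ ^ 2 ∂μ) / M := by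
  have hc : Integrable (fun ξ => max (-M) (min M (f ξ))) μ := by
    refine Integrable.of_bound (by fun_prop) M (ae_of_all _ fun ξ => ?_)
    exact abs_clamp_le hM _
  rw [← integral_sub hi hc, ← integral_div]
  refine (abs_integral_le_integral_abs).trans ?_
  exact integral_mono (hi.sub hc).abs (hi2.div_const M) fun ξ => abs_sub_clamp_le hM _

lemma measure_norm_gt_le (μ : Measure ℝ) (hi : Integrable (fun ξ : ℝ => ξ ^ 2) μ)
    {C : ℝ} (hC : ∫ ξ, ξ ^ 2 ∂μ ≤ C) {r : ℝ} (hr : 0 < r) :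
    μ {x | r < ‖x‖} ≤ ENNReal.ofReal (C / r ^ 2) := by
  have h2 : 0 < r ^ 2 := by positivity
  have h1 := mul_meas_ge_le_lintegral (μ := μ)
    (f := fun ξ : ℝ => ENNReal.ofReal (ξ ^ 2)) (by fun_prop) (ENNReal.ofReal (r ^ 2))
  rw [← ofReal_integral_eq_lintegral_ofReal hi (ae_of_all _ fun ξ => sq_nonneg ξ)] at h1
  rw [ENNReal.ofReal_div_of_pos h2, ENNReal.le_div_iff_mul_le (by simp [hr.ne']) (by simp), mul_comm]
  refine le_trans ?_ (h1.trans (ENNReal.ofReal_le_ofReal hC))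
  gcongr
  intro hx
  rw [← sq_abs x]
  exact ENNReal.ofReal_le_ofReal (by rw [Real.norm_eq_abs] at hx; gcongr)

lemma isTightMeasureSet_of_integral_sq_le (ν : ℕ → ProbabilityMeasure ℝ) (C : ℝ)
    (hi : ∀ N, Integrable (fun ξ : ℝ => ξ ^ 2) (ν N : Measure ℝ))
    (hC : ∀ N, ∫ ξ, ξ ^ 2 ∂(ν N : Measure ℝ) ≤ C) :
    IsTightMeasureSet {x : Measure ℝ | ∃ μ ∈ Set.range ν, (μ : Measure ℝ) = x} := by
  apply isTightMeasureSet_of_tendsto_measure_norm_gt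
  have hlim : Tendsto (fun r : ℝ => ENNReal.ofReal (C / r ^ 2)) atTop (𝓝 0) := by
    rw [← ENNReal.ofReal_zero]
    refine (ENNReal.continuous_ofReal.tendsto 0).comp ?_
    exact tendsto_const_nhds.div_atTop (tendsto_pow_atTop two_ne_zero)
  refine tendsto_of_tendsto_of_tendsto_of_le_of_le' tendsto_const_nhds hlim
    (Eventually.of_forall fun _ => zero_le) ?_
  filter_upwards [eventually_gt_atTop 0] with r hr
  refine iSup₂_le ?_
  rintro x ⟨μ, ⟨N, rfl⟩, rfl⟩
  exact measure_norm_gt_le _ (hi N) (hC N) hr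

/-- If a sequence of probability measures has bounded second moments and eventually constant
moments, then there is a probability measure with these moments. -/
theorem exists_measure_of_eventually_moments_eq (ν : ℕ → ProbabilityMeasure ℝ) (m : ℕ → ℝ) (C : ℝ)
    (hi : ∀ N k, Integrable (fun ξ : ℝ => ξ ^ k) (ν N : Measure ℝ))
    (hC : ∀ N, ∫ ξ, ξ ^ 2 ∂(ν N : Measure ℝ) ≤ C)
    (hm : ∀ k, ∀ᶠ N in atTop, ∫ ξ, ξ ^ k ∂(ν N : Measure ℝ) = m k) :
    ∃ μ : ProbabilityMeasure ℝ, (∀ k, Integrable (fun ξ : ℝ => ξ ^ k) (μ : Measure ℝ)) ∧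
      ∀ k, ∫ ξ, ξ ^ k ∂(μ : Measure ℝ) = m k := by
  have hK := isCompact_closure_of_isTightMeasureSet
    (isTightMeasureSet_of_integral_sq_le ν C (fun N => hi N 2) hC)
  -- An ultrafilter finer than `atTop` replaces the choice of a convergent subsequence; eventual
  -- equalities of moments survive along it.
  set U : Ultrafilter ℕ := Ultrafilter.of atTop
  have hU : (U : Filter ℕ) ≤ atTop := Ultrafilter.of_le _
  obtain ⟨μ, -, hμ⟩ := hK.ultrafilter_le_nhds (U.map ν) (by
    rw [le_principal_iff]
    exact Filter.mem_of_superset (Filter.mem_map.2 (Filter.univ_mem' fun n => Set.mem_range_self n))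
      subset_closure)
  have ht : Tendsto ν U (𝓝 μ) := hμ
  rw [ProbabilityMeasure.tendsto_iff_forall_integral_tendsto] at ht
  have hbdd : ∀ f : ℝ → ℝ, Continuous f → ∀ M, (∀ x, |f x| ≤ M) →
      Tendsto (fun N => ∫ ξ, f ξ ∂(ν N : Measure ℝ)) U (𝓝 (∫ ξ, f ξ ∂(μ : Measure ℝ))) := by
    intro f hf M hM
    exact ht (BoundedContinuousFunction.ofNormedAddCommGroup f hf M hM)
  -- Powers are unbounded, so weak convergence does not apply to them directly. Truncation and Fatou
  -- give an upper bound for even moments, which suffices to control the truncation error below.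
  have heven : ∀ k, Integrable (fun ξ : ℝ => (ξ ^ k) ^ 2) (μ : Measure ℝ) ∧
      ∫ ξ, (ξ ^ k) ^ 2 ∂(μ : Measure ℝ) ≤ m (k * 2) := by
    intro k
    have h0 : ∀ M : ℕ, ∫⁻ ξ, ENNReal.ofReal (min ((ξ ^ k) ^ 2) M) ∂(μ : Measure ℝ) ≤
        ENNReal.ofReal (m (k * 2)) := by
      intro M
      have hb : ∀ x : ℝ, |min ((x ^ k) ^ 2) (M : ℝ)| ≤ M := fun x => by
        rw [abs_of_nonneg (by positivity)]; exact min_le_right _ _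
      rw [← ofReal_integral_eq_lintegral_ofReal]
      · apply ENNReal.ofReal_le_ofReal
        refine le_of_tendsto (hbdd _ (by fun_prop) M hb) (hU ?_)
        filter_upwards [hm (k * 2)] with N hN
        rw [← hN]
        refine integral_mono ?_ (hi N _) fun ξ => ?_
        · exact Integrable.of_bound (by fun_prop) M (ae_of_all _ hb)
        · simp [pow_mul]
      · exact Integrable.of_bound (by fun_prop) M (ae_of_all _ hb)
      · exact ae_of_all _ fun x => by positivity
    have h1 : ∫⁻ ξ, ENNReal.ofReal ((ξ ^ k) ^ 2) ∂(μ : Measure ℝ) ≤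
        ENNReal.ofReal (m (k * 2)) := by
      have h2 : ∀ ξ : ℝ, ENNReal.ofReal ((ξ ^ k) ^ 2) =
          liminf (fun M : ℕ => ENNReal.ofReal (min ((ξ ^ k) ^ 2) M)) atTop := by
        intro ξ
        refine (Tendsto.liminf_eq ?_).symm
        refine tendsto_const_nhds.congr' ?_
        obtain ⟨M₀, hM₀⟩ := exists_nat_ge ((ξ ^ k) ^ 2)
        filter_upwards [eventually_ge_atTop M₀] with M hM
        rw [min_eq_left (hM₀.trans (by exact_mod_cast hM))]
      simp_rw [h2]
      refine (lintegral_liminf_le fun M => by fun_prop).trans ?_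
      exact liminf_le_of_le (by isBoundedDefault) fun b hb => by
        obtain ⟨M, hM⟩ := hb.exists
        exact hM.trans (h0 M)
    have hint : Integrable (fun ξ : ℝ => (ξ ^ k) ^ 2) (μ : Measure ℝ) := by
      refine ⟨by fun_prop, ?_⟩
      rw [hasFiniteIntegral_iff_ofReal (ae_of_all _ fun x => by positivity)]
      exact h1.trans_lt ENNReal.ofReal_lt_top
    refine ⟨hint, ?_⟩
    rw [← ofReal_integral_eq_lintegral_ofReal hint (ae_of_all _ fun x => by positivity)] at h1
    have hnn : 0 ≤ m (k * 2) := by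
      obtain ⟨N, hN⟩ := (hm (k * 2)).exists
      rw [← hN]
      exact integral_nonneg fun ξ => by simp only [pow_mul]; positivity
    exact (ENNReal.ofReal_le_ofReal_iff hnn).1 h1
  have hint : ∀ k, Integrable (fun ξ : ℝ => ξ ^ k) (μ : Measure ℝ) := by
    intro k
    have : MemLp (fun ξ : ℝ => ξ ^ k) 2 (μ : Measure ℝ) :=
      (memLp_two_iff_integrable_sq (by fun_prop)).2 (heven k).1
    exact this.integrable (by norm_num)
  refine ⟨μ, hint, fun k => ?_⟩
  -- Truncating `ξ ^ k` at height `M` costs at most `m (k * 2) / M` both for `μ` and for all late `ν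
  -- N`, while the truncated means converge.
  have hkey : ∀ M : ℝ, 0 < M →
      |m k - ∫ ξ, ξ ^ k ∂(μ : Measure ℝ)| ≤ 2 * m (k * 2) / M := by
    intro M hM
    have e1 : |∫ ξ, max (-M) (min M (ξ ^ k)) ∂(μ : Measure ℝ) - m k| ≤ m (k * 2) / M := by
      have hl := ((hbdd (fun ξ => max (-M) (min M (ξ ^ k))) (by fun_prop) M
        (fun x => abs_clamp_le hM _)).sub_const (m k)).abs
      refine le_of_tendsto hl (hU ?_)
      filter_upwards [hm k, hm (k * 2)] with N h1 h2
      have := abs_integral_sub_integral_clamp_le (ν N : Measure ℝ) (f := fun ξ => ξ ^ k)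
        (by fun_prop) (hi N k) (by simpa only [pow_mul] using hi N (k * 2)) hM
      rw [h1] at this
      rw [abs_sub_comm]
      simpa only [← pow_mul, h2] using this
    have e2 := abs_integral_sub_integral_clamp_le (μ : Measure ℝ) (f := fun ξ => ξ ^ k)
        (by fun_prop) (hint k) (heven k).1 hM
    have e3 := e2.trans (div_le_div_of_nonneg_right (heven k).2 hM.le)
    rw [abs_le] at *
    have : 2 * m (k * 2) / M = m (k * 2) / M + m (k * 2) / M := by ring
    constructor <;> linarith
  have hlim : Tendsto (fun M : ℝ => 2 * m (k * 2) / M) atTop (𝓝 0) :=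
    tendsto_const_nhds.div_atTop tendsto_id
  have := ge_of_tendsto hlim (by filter_upwards [eventually_gt_atTop 0] with M hM using hkey M hM)
  have := abs_nonpos_iff.1 this
  linarith

/-! ### Three-term recurrences and truncated Jacobi matrices -/

/-- The three-term recurrence `X p₀ = b₀ p₁`, `X pₙ₊₁ = bₙ pₙ + bₙ₊₁ pₙ₊₂`. -/
structure SatisfiesThreeTermRecurrence (p : ℕ → Polynomial ℝ) (b : ℕ → ℝ) : Prop where
  zero : Polynomial.X * p 0 = Polynomial.C (b 0) * p 1
  succ : ∀ n, Polynomial.X * p (n + 1) =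
    Polynomial.C (b n) * p n + Polynomial.C (b (n + 1)) * p (n + 2)

/-- The polynomials generated from `1` by the three-term recurrence with coefficients `b`. -/
noncomputable def recurrencePoly (b : ℕ → ℝ) : ℕ → Polynomial ℝ
  | 0 => 1
  | 1 => Polynomial.C (b 0)⁻¹ * Polynomial.X
  | n + 2 => Polynomial.C (b (n + 1))⁻¹ *
      (Polynomial.X * recurrencePoly b (n + 1) - Polynomial.C (b n) * recurrencePoly b n)

lemma recurrencePoly_satisfies {b : ℕ → ℝ} (hb : ∀ n, 0 < b n) :
    SatisfiesThreeTermRecurrence (recurrencePoly b) b := by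
  constructor
  · simp only [recurrencePoly]
    rw [← mul_assoc, ← Polynomial.C_mul, mul_inv_cancel₀ (hb 0).ne']
    simp
  · intro n
    simp only [recurrencePoly]
    rw [← mul_assoc (Polynomial.C _), ← Polynomial.C_mul, mul_inv_cancel₀ (hb _).ne']
    simp

lemma recurrencePoly_degree {b : ℕ → ℝ} (hb : ∀ n, 0 < b n) (n : ℕ) :
    (recurrencePoly b n).natDegree = n ∧ 0 < (recurrencePoly b n).leadingCoeff := by
  induction n using Nat.strong_induction_on with
  | _ n ih =>
    match n with
    | 0 => simp [recurrencePoly]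
    | 1 =>
      have h : (b 0)⁻¹ ≠ 0 := inv_ne_zero (hb 0).ne'
      simp only [recurrencePoly]
      rw [Polynomial.natDegree_C_mul_X _ h]
      simp [hb 0]
    | n + 2 =>
      have h : (b (n + 1))⁻¹ ≠ 0 := inv_ne_zero (hb _).ne'
      obtain ⟨h1, h2⟩ := ih (n + 1) (by omega)
      obtain ⟨h3, -⟩ := ih n (by omega)
      have hne : recurrencePoly b (n + 1) ≠ 0 := Polynomial.leadingCoeff_ne_zero.1 h2.ne'
      have hX : (Polynomial.X * recurrencePoly b (n + 1)).natDegree = n + 2 := by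
        rw [Polynomial.natDegree_X_mul hne, h1]
      have hlt : (Polynomial.C (b n) * recurrencePoly b n).natDegree <
          (Polynomial.X * recurrencePoly b (n + 1)).natDegree := by
        rw [hX]
        exact (Polynomial.natDegree_C_mul_le _ _).trans_lt (by omega)
      simp only [recurrencePoly]
      rw [Polynomial.natDegree_C_mul h, Polynomial.natDegree_sub_eq_left_of_natDegree_lt hlt, hX,
        Polynomial.leadingCoeff_mul, Polynomial.leadingCoeff_C,
        Polynomial.leadingCoeff_sub_of_degree_lt (Polynomial.degree_lt_degree hlt)]
      refine ⟨rfl, mul_pos (inv_pos.2 (hb _)) ?_⟩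
      simpa using h2

/-- Truncated Jacobi matrix with zero diagonal and off-diagonal entries `b`. -/
def jacobiMatrix (b : ℕ → ℝ) (N : ℕ) : Matrix (Fin (N + 1)) (Fin (N + 1)) ℝ :=
  Matrix.of fun i j =>
    (if (i : ℕ) + 1 = j then b i else 0) + (if (j : ℕ) + 1 = i then b j else 0)

lemma jacobiMatrix_isHermitian (b : ℕ → ℝ) (N : ℕ) : (jacobiMatrix b N).IsHermitian := by
  ext i j
  simp [jacobiMatrix, add_comm]

/-- Every row of the eigenvalue equation but the last is the three-term recurrence evaluated at `l`,
so the first coordinate determines the rest. The last row, which singles out the eigenvalues, plays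
no role. -/
lemma eigenvector_coord_eq {p : ℕ → Polynomial ℝ} {b : ℕ → ℝ} (hb : ∀ n, 0 < b n)
    (hp : SatisfiesThreeTermRecurrence p b) (h0 : p 0 = 1) {N : ℕ} {v : Fin (N + 1) → ℝ} {l : ℝ}
    (hv : (jacobiMatrix b N).mulVec v = l • v) (n : Fin (N + 1)) :
    v n = (p n).eval l * v 0 := by
  set w : ℕ → ℝ := fun n => if h : n < N + 1 then v ⟨n, h⟩ else 0 with hw
  have hwv : ∀ n : Fin (N + 1), v n = w n := fun n => by simp only [hw, n.2, dif_pos]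
  -- The lower neighbour stays written as a sum because it is absent for `i = 0`.
  have hrow : ∀ i < N, l * w i = b i * w (i + 1) +
      ∑ j ∈ Finset.range (N + 1), if j + 1 = i then b j * w j else 0 := by
    intro i hi
    have h := congrFun hv ⟨i, by omega⟩
    simp only [Matrix.mulVec, dotProduct, jacobiMatrix, Matrix.of_apply, Pi.smul_apply,
      smul_eq_mul, hwv] at h
    rw [← h, Fin.sum_univ_eq_sum_range (fun j => ((if i + 1 = j then b i else 0) +
      (if j + 1 = i then b j else 0)) * w j)]
    simp only [add_mul, Finset.sum_add_distrib, ite_mul, zero_mul]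
    congr 1
    rw [Finset.sum_ite_eq, if_pos (Finset.mem_range.2 (by omega))]
  have key : ∀ n < N + 1, w n = (p n).eval l * w 0 := by
    intro n
    induction n using Nat.strong_induction_on with
    | _ n ih =>
      intro hn
      match n with
      | 0 => simp [h0]
      | 1 =>
        have h1 := hrow 0 (by omega)
        have h2 := congrArg (Polynomial.eval l) hp.zero
        simp [h0] at h1 h2
        apply mul_left_cancel₀ (hb 0).ne'
        linear_combination (-1 : ℝ) * h1 + w 0 * h2
      | n + 2 =>
        have h1 := hrow (n + 1) (by omega)
        have h2 := congrArg (Polynomial.eval l) (hp.succ n)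
        simp only [add_left_inj, Finset.sum_ite_eq', Finset.mem_range] at h1
        rw [if_pos (by omega), ih n (by omega) (by omega), ih (n + 1) (by omega) (by omega)] at h1
        simp at h2
        apply mul_left_cancel₀ (hb (n + 1)).ne'
        linear_combination (-1 : ℝ) * h1 + w 0 * h2
  rw [hwv, key n n.2, hwv 0, Fin.val_zero]

/-- The spectral measure of a truncated Jacobi matrix makes finitely many of the polynomials
orthonormal. -/
theorem exists_measure_orthonormal_le {p : ℕ → Polynomial ℝ} {b : ℕ → ℝ} (hb : ∀ n, 0 < b n)
    (hp : SatisfiesThreeTermRecurrence p b) (h0 : p 0 = 1) (N : ℕ) :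
    ∃ ν : ProbabilityMeasure ℝ, (∀ q : Polynomial ℝ, Integrable (fun ξ => q.eval ξ) (ν : Measure ℝ)) ∧
      ∀ m ≤ N, ∀ n ≤ N, ∫ ξ, (p m).eval ξ * (p n).eval ξ ∂(ν : Measure ℝ) =
        if m = n then 1 else 0 := by
  set hA := jacobiMatrix_isHermitian b N
  set v := hA.eigenvectorBasis
  set l := hA.eigenvalues
  -- The spectral measure of the first basis vector: mass `(v j 0) ^ 2` at the eigenvalue `l j`.
  set ν : Measure ℝ := ∑ j, ENNReal.ofReal ((v j 0) ^ 2) • Measure.dirac (l j) with hν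
  have hi : ∀ q : Polynomial ℝ, ∀ j ∈ Finset.univ, Integrable (fun ξ => q.eval ξ)
      (ENNReal.ofReal ((v j 0) ^ 2) • Measure.dirac (l j)) := fun q j _ =>
    (integrable_dirac (by simp)).smul_measure (by simp)
  have hint : ∀ q : Polynomial ℝ, ∫ ξ, q.eval ξ ∂ν = ∑ j, (v j 0) ^ 2 * q.eval (l j) := by
    intro q
    rw [hν, integral_finsetSum_measure (hi q)]
    refine Finset.sum_congr rfl fun j _ => ?_
    rw [integral_smul_measure, integral_dirac, ENNReal.toReal_ofReal (sq_nonneg _), smul_eq_mul]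
  have horth : ∀ m ≤ N, ∀ n ≤ N, ∫ ξ, (p m).eval ξ * (p n).eval ξ ∂ν =
        if m = n then 1 else 0 := by
    intro m hm n hn
    have h1 := hint (p m * p n)
    simp only [Polynomial.eval_mul] at h1
    rw [h1]
    -- Parseval for two standard basis vectors in the eigenbasis becomes orthonormality of `p m`, `p
    -- n` once each coordinate is written as `(p k).eval (l j) * v j 0`.
    have h2 := OrthonormalBasis.sum_inner_mul_inner v
      (EuclideanSpace.single (⟨m, by omega⟩ : Fin (N + 1)) (1 : ℝ))
      (EuclideanSpace.single (⟨n, by omega⟩ : Fin (N + 1)) (1 : ℝ))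
    simp only [EuclideanSpace.inner_single_left, EuclideanSpace.inner_single_right] at h2
    have h3 : ∀ j, ∀ k : Fin (N + 1), v j k = (p k).eval (l j) * v j 0 := fun j k =>
      eigenvector_coord_eq hb hp h0 (hA.mulVec_eigenvectorBasis j) k
    simp only [h3 _ ⟨m, _⟩, h3 _ ⟨n, _⟩] at h2
    simp at h2
    simp only [eq_comm (a := m), ← h2]
    exact Finset.sum_congr rfl fun j _ => by ring
  have hprob : IsProbabilityMeasure ν := by
    constructor
    have h' := horth 0 (by omega) 0 (by omega)
    have h4 : ∑ j, (v j 0) ^ 2 = 1 := by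
      have := hint (p 0 * p 0)
      simp only [Polynomial.eval_mul] at this
      rw [h'] at this
      simpa [h0] using this.symm
    simp only [hν, Measure.coe_finsetSum, Finset.sum_apply, Measure.smul_apply, measure_univ,
      smul_eq_mul, mul_one]
    rw [← ENNReal.ofReal_sum_of_nonneg fun j _ => sq_nonneg _, h4, ENNReal.ofReal_one]
  refine ⟨⟨ν, hprob⟩, fun q => ?_, horth⟩
  exact integrable_finsetSum_measure.2 (hi q)

/-! ### Orthonormal polynomial systems -/

lemma exists_eq_sum_of_degree_lt {p : ℕ → Polynomial ℝ} (hdeg : ∀ n, (p n).natDegree = n)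
    (hlc : ∀ n, 0 < (p n).leadingCoeff) (N : ℕ) (q : Polynomial ℝ) (hq : q.degree < N) :
    ∃ c : ℕ → ℝ, q = ∑ k ∈ Finset.range N, Polynomial.C (c k) * p k := by
  induction N generalizing q with
  | zero => exact ⟨0, by simpa [Polynomial.degree_eq_bot] using hq⟩
  | succ N ih =>
    have hN : (p N).coeff N ≠ 0 := by
      have := (hlc N).ne'
      rwa [Polynomial.leadingCoeff, hdeg] at this
    set a := q.coeff N / (p N).coeff N
    have hr : (q - Polynomial.C a * p N).degree < N := by
      rw [Polynomial.degree_lt_iff_coeff_zero] at hq ⊢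
      intro m hm
      rw [Polynomial.coeff_sub, Polynomial.coeff_C_mul]
      rcases hm.eq_or_lt with rfl | hm
      · simp [a, hN]
      · rw [hq m hm, Polynomial.coeff_eq_zero_of_natDegree_lt (by rwa [hdeg])]
        simp
    obtain ⟨c, hc⟩ := ih _ hr
    refine ⟨Function.update c N a, ?_⟩
    rw [Finset.sum_range_succ, Function.update_self]
    rw [Finset.sum_congr rfl fun k hk => by
      rw [Function.update_of_ne (Finset.mem_range.1 hk).ne], ← hc]
    ring

lemma integrable_eval_of_moments {μ : Measure ℝ} (hm : ∀ n : ℕ, Integrable (fun ξ : ℝ => ξ ^ n) μ)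
    (q : Polynomial ℝ) : Integrable (fun ξ => q.eval ξ) μ := by
  simp only [Polynomial.eval_eq_sum_range]
  exact integrable_finsetSum _ fun k _ => (hm k).const_mul _

lemma integral_eval_eq_sum {μ : Measure ℝ} (hm : ∀ n : ℕ, Integrable (fun ξ : ℝ => ξ ^ n) μ)
    (q : Polynomial ℝ) :
    ∫ ξ, q.eval ξ ∂μ = ∑ k ∈ Finset.range (q.natDegree + 1), q.coeff k * ∫ ξ, ξ ^ k ∂μ := by
  simp only [Polynomial.eval_eq_sum_range]
  rw [integral_finsetSum _ fun k _ => (hm k).const_mul _]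
  simp only [integral_const_mul]

namespace IsOrthonormalPolynomialSystem

variable {μ : Measure ℝ} {p : ℕ → Polynomial ℝ}

/-- Expansion of a polynomial in the orthonormal polynomials. -/
lemma eq_sum (hp : IsOrthonormalPolynomialSystem μ p)
    (hm : ∀ n : ℕ, Integrable (fun ξ : ℝ => ξ ^ n) μ) {N : ℕ} {q : Polynomial ℝ}
    (hq : q.degree < N) :
    q = ∑ k ∈ Finset.range N, Polynomial.C (∫ ξ, q.eval ξ * (p k).eval ξ ∂μ) * p k := by
  obtain ⟨c, hc⟩ := exists_eq_sum_of_degree_lt hp.natDegree_eq hp.leadingCoeff_pos N q hq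
  nth_rewrite 1 [hc]
  refine Finset.sum_congr rfl fun k hk => ?_
  congr 2
  have h1 : ∀ ξ, q.eval ξ * (p k).eval ξ =
      ∑ j ∈ Finset.range N, c j * ((p j).eval ξ * (p k).eval ξ) := by
    intro ξ
    nth_rewrite 1 [hc]
    rw [Polynomial.eval_finsetSum, Finset.sum_mul]
    exact Finset.sum_congr rfl fun j _ => by simp; ring
  simp only [h1]
  rw [integral_finsetSum]
  · simp only [integral_const_mul, hp.orthonormal]
    simp only [mul_ite, mul_one, mul_zero, Finset.sum_ite_eq', hk, if_true]
  · intro j _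
    have := integrable_eval_of_moments hm (p j * p k)
    simp only [Polynomial.eval_mul] at this
    exact this.const_mul _

lemma integral_mul_eq_zero (hp : IsOrthonormalPolynomialSystem μ p)
    (hm : ∀ n : ℕ, Integrable (fun ξ : ℝ => ξ ^ n) μ) {n : ℕ} {q : Polynomial ℝ}
    (hq : q.degree < n) : ∫ ξ, q.eval ξ * (p n).eval ξ ∂μ = 0 := by
  obtain ⟨c, hc⟩ := exists_eq_sum_of_degree_lt hp.natDegree_eq hp.leadingCoeff_pos n q hq
  have h1 : ∀ ξ, q.eval ξ * (p n).eval ξ =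
      ∑ j ∈ Finset.range n, c j * ((p j).eval ξ * (p n).eval ξ) := by
    intro ξ
    rw [hc, Polynomial.eval_finsetSum, Finset.sum_mul]
    exact Finset.sum_congr rfl fun j _ => by simp; ring
  simp only [h1]
  rw [integral_finsetSum]
  · refine Finset.sum_eq_zero fun j hj => ?_
    rw [integral_const_mul, hp.orthonormal, if_neg (Finset.mem_range.1 hj).ne, mul_zero]
  · intro j _
    have := integrable_eval_of_moments hm (p j * p n)
    simp only [Polynomial.eval_mul] at this
    exact this.const_mul _

lemma degree_eq (hp : IsOrthonormalPolynomialSystem μ p) (n : ℕ) : (p n).degree = n := by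
  rw [Polynomial.degree_eq_natDegree
    (Polynomial.leadingCoeff_ne_zero.1 (hp.leadingCoeff_pos n).ne'), hp.natDegree_eq]

/-- A measure that has an orthonormal polynomial system is not carried by a finite set. -/
theorem hasInfinitelyManyPointsOfIncrease (hp : IsOrthonormalPolynomialSystem μ p)
    (hm : ∀ n : ℕ, Integrable (fun ξ : ℝ => ξ ^ n) μ) : HasInfinitelyManyPointsOfIncrease μ := by
  intro hfin
  have hsupp : {x : ℝ | ∀ ε : ℝ, 0 < ε → 0 < μ (Set.Ioo (x - ε) (x + ε))} = μ.support := by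
    ext x
    exact (((nhds_basis_Ioo_pos x).mem_measureSupport).symm)
  rw [hsupp] at hfin
  -- If the support were finite, this nonzero polynomial would vanish almost everywhere, so all its
  -- coefficients in the orthonormal expansion would be zero.
  set q : Polynomial ℝ := ∏ x ∈ hfin.toFinset, (Polynomial.X - Polynomial.C x)
  have hq : q ≠ 0 := Finset.prod_ne_zero_iff.2 fun x _ => Polynomial.X_sub_C_ne_zero x
  have hae : ∀ᵐ ξ ∂μ, q.eval ξ = 0 := by
    filter_upwards [Measure.support_mem_ae (μ := μ)] with ξ hξ
    rw [Polynomial.eval_prod]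
    exact Finset.prod_eq_zero (hfin.mem_toFinset.2 hξ) (by simp)
  apply hq
  rw [hp.eq_sum hm (N := q.natDegree + 1) (q := q)
    (Polynomial.degree_le_natDegree.trans_lt (by exact_mod_cast Nat.lt_succ_self _))]
  refine Finset.sum_eq_zero fun k _ => ?_
  rw [integral_eq_zero_of_ae (by filter_upwards [hae] with ξ hξ; simp [hξ])]
  simp

/-- The orthonormal polynomials of a symmetric measure are alternately even and odd. -/
theorem comp_neg_X (hp : IsOrthonormalPolynomialSystem μ p)
    (hm : ∀ n : ℕ, Integrable (fun ξ : ℝ => ξ ^ n) μ) (hs : μ.map (fun ξ : ℝ => -ξ) = μ) (n : ℕ) :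
    (p n).comp (-Polynomial.X) = Polynomial.C ((-1) ^ n) * p n := by
  set q := (p n).comp (-Polynomial.X) with hqdef
  have hnat : q.natDegree = n := by
    rw [hqdef, Polynomial.natDegree_comp, hp.natDegree_eq]; simp
  have hdeg : q.degree < (n + 1 : ℕ) :=
    Polynomial.degree_le_natDegree.trans_lt (by rw [hnat]; exact_mod_cast Nat.lt_succ_self _)
  have h := hp.eq_sum hm hdeg
  -- By symmetry of `μ` the reflection moves onto `p k`, whose degree stays below `n`; orthogonality
  -- to `p n` leaves only the top term.
  have hz : ∀ k ∈ Finset.range n,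
      Polynomial.C (∫ ξ, q.eval ξ * (p k).eval ξ ∂μ) * p k = 0 := by
    intro k hk
    have h1 : ((p k).comp (-Polynomial.X)).degree < n := by
      refine Polynomial.degree_le_natDegree.trans_lt ?_
      rw [Polynomial.natDegree_comp, hp.natDegree_eq]
      simpa using hk
    have h2 := hp.integral_mul_eq_zero hm h1
    rw [← hs, integral_map (by fun_prop)
      (by apply Continuous.aestronglyMeasurable; fun_prop)] at h2
    have h3 : ∫ ξ, q.eval ξ * (p k).eval ξ ∂μ = 0 := by
      rw [← h2]
      refine integral_congr_ae (ae_of_all _ fun ξ => ?_)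
      simp [hqdef, mul_comm]
    rw [h3]; simp
  rw [Finset.sum_range_succ, Finset.sum_eq_zero hz, zero_add] at h
  set a := ∫ ξ, q.eval ξ * (p n).eval ξ ∂μ
  have hl : q.leadingCoeff = (-1) ^ n * (p n).leadingCoeff := by
    rw [hqdef, Polynomial.comp_neg_X_leadingCoeff_eq, hp.natDegree_eq]
  rw [h, Polynomial.leadingCoeff_mul, Polynomial.leadingCoeff_C] at hl
  rw [h, mul_right_cancel₀ (hp.leadingCoeff_pos n).ne' hl]

lemma eval_neg (hp : IsOrthonormalPolynomialSystem μ p)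
    (hm : ∀ n : ℕ, Integrable (fun ξ : ℝ => ξ ^ n) μ) (hs : μ.map (fun ξ : ℝ => -ξ) = μ) (n : ℕ)
    (x : ℝ) : (p n).eval (-x) = (-1) ^ n * (p n).eval x := by
  have := congrArg (Polynomial.eval x) (hp.comp_neg_X hm hs n)
  simpa using this

/-- The orthonormal polynomials of a symmetric measure satisfy a three-term recurrence. -/
theorem exists_satisfiesThreeTermRecurrence (hp : IsOrthonormalPolynomialSystem μ p)
    (hm : ∀ n : ℕ, Integrable (fun ξ : ℝ => ξ ^ n) μ) (hs : μ.map (fun ξ : ℝ => -ξ) = μ) :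
    ∃ b : ℕ → ℝ, (∀ n, 0 < b n) ∧ SatisfiesThreeTermRecurrence p b := by
  have hX : ∀ n : ℕ, (Polynomial.X * p n).degree < ((n + 2 : ℕ) : WithBot ℕ) := by
    intro n
    rw [Polynomial.degree_mul, Polynomial.degree_X, hp.degree_eq]
    norm_cast; omega
  -- The integrand `ξ * p n ξ ^ 2` is odd, so a symmetric measure gives a zero diagonal.
  have hdiag : ∀ n, ∫ ξ, (Polynomial.X * p n).eval ξ * (p n).eval ξ ∂μ = 0 := by
    intro n
    have h : ∫ ξ, (Polynomial.X * p n).eval ξ * (p n).eval ξ ∂μ =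
        -∫ ξ, (Polynomial.X * p n).eval ξ * (p n).eval ξ ∂μ := by
      nth_rewrite 1 [← hs]
      rw [integral_map (by fun_prop) (by apply Continuous.aestronglyMeasurable; fun_prop),
        ← integral_neg]
      refine integral_congr_ae (ae_of_all _ fun ξ => ?_)
      simp only [Polynomial.eval_mul, Polynomial.eval_X, hp.eval_neg hm hs]
      have : ((-1 : ℝ) ^ n) * (-1) ^ n = 1 := by rw [← mul_pow]; simp
      linear_combination (-ξ * (p n).eval ξ ^ 2) * this
    linarith
  have hsymm : ∀ n k, ∫ ξ, (Polynomial.X * p n).eval ξ * (p k).eval ξ ∂μ =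
      ∫ ξ, (Polynomial.X * p k).eval ξ * (p n).eval ξ ∂μ := by
    intro n k
    refine integral_congr_ae (ae_of_all _ fun ξ => ?_)
    simp only [Polynomial.eval_mul, Polynomial.eval_X]; ring
  set b : ℕ → ℝ := fun n => ∫ ξ, (Polynomial.X * p n).eval ξ * (p (n + 1)).eval ξ ∂μ with hb
  have hrec : SatisfiesThreeTermRecurrence p b := by
    constructor
    · have := hp.eq_sum hm (hX 0)
      rw [Finset.sum_range_succ, Finset.sum_range_one, hdiag] at this
      simpa [hb] using this
    · intro n
      have := hp.eq_sum hm (hX (n + 1))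
      rw [Finset.sum_range_succ, Finset.sum_range_succ, Finset.sum_range_succ, hdiag,
        Finset.sum_eq_zero, hsymm (n + 1) n] at this
      · simpa [hb] using this
      · intro k hk
        rw [hsymm, hp.integral_mul_eq_zero hm]
        · simp
        · refine (hX k).trans_le ?_
          have := Finset.mem_range.1 hk
          exact_mod_cast (by omega : k + 2 ≤ n + 1)
  refine ⟨b, fun n => ?_, hrec⟩
  -- Comparing leading coefficients in the recurrence transfers positivity to `b n`.
  have hcoef : (p n).leadingCoeff = b n * (p (n + 1)).leadingCoeff := by
    have h0 := hp.natDegree_eq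
    simp only [Polynomial.leadingCoeff, h0]
    cases n with
    | zero =>
      have := congrArg (fun q => Polynomial.coeff q 1) hrec.zero
      simpa [Polynomial.coeff_X_mul] using this
    | succ n =>
      have := congrArg (fun q => Polynomial.coeff q (n + 2)) (hrec.succ n)
      simp only [Polynomial.coeff_X_mul, Polynomial.coeff_add, Polynomial.coeff_C_mul] at this
      rw [this, Polynomial.coeff_eq_zero_of_natDegree_lt (p := p n) (by rw [h0]; omega)]
      ring
  have h1 := hp.leadingCoeff_pos n
  rw [hcoef] at h1
  exact pos_of_mul_pos_left h1 (hp.leadingCoeff_pos _).le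

end IsOrthonormalPolynomialSystem

/-! ### Favard's theorem with zero diagonal -/

lemma SatisfiesThreeTermRecurrence.eval_neg {p : ℕ → Polynomial ℝ} {b : ℕ → ℝ}
    (hb : ∀ n, 0 < b n) (hp : SatisfiesThreeTermRecurrence p b) (h0 : p 0 = 1) (n : ℕ) (x : ℝ) :
    (p n).eval (-x) = (-1) ^ n * (p n).eval x := by
  induction n using Nat.strong_induction_on with
  | _ n ih =>
    match n with
    | 0 => simp [h0]
    | 1 =>
      have h1 := congrArg (Polynomial.eval x) hp.zero
      have h2 := congrArg (Polynomial.eval (-x)) hp.zero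
      simp [h0] at h1 h2
      apply mul_left_cancel₀ (hb 0).ne'
      linear_combination (-1 : ℝ) * h1 - h2
    | n + 2 =>
      have h1 := congrArg (Polynomial.eval x) (hp.succ n)
      have h2 := congrArg (Polynomial.eval (-x)) (hp.succ n)
      simp [ih n (by omega), ih (n + 1) (by omega)] at h1 h2
      apply mul_left_cancel₀ (hb (n + 1)).ne'
      rw [pow_add] at *
      linear_combination (-1) ^ n * h1 - h2

/-- Favard's theorem for recurrences with zero diagonal: the polynomials of the recurrence are
orthonormal with respect to a symmetric probability measure. -/
theorem exists_symmetric_orthonormal_measure {p : ℕ → Polynomial ℝ} {b : ℕ → ℝ}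
    (hb : ∀ n, 0 < b n) (hp : SatisfiesThreeTermRecurrence p b) (h0 : p 0 = 1)
    (hdeg : ∀ n, (p n).natDegree = n) (hlc : ∀ n, 0 < (p n).leadingCoeff) :
    ∃ μ : Measure ℝ, IsProbabilityMeasure μ ∧ (∀ n : ℕ, Integrable (fun ξ : ℝ => ξ ^ n) μ) ∧
      IsOrthonormalPolynomialSystem μ p ∧ μ.map (fun ξ : ℝ => -ξ) = μ := by
  choose ν hνi hνo using exists_measure_orthonormal_le hb hp h0
  have hνm : ∀ N (k : ℕ), Integrable (fun ξ : ℝ => ξ ^ k) (ν N : Measure ℝ) := fun N k => by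
    simpa using hνi N (Polynomial.X ^ k)
  have hX : ∀ k : ℕ, (Polynomial.X ^ k : Polynomial ℝ).degree < (k + 1 : ℕ) := fun k => by
    rw [Polynomial.degree_X_pow]; exact_mod_cast Nat.lt_succ_self k
  choose c hc using fun k => exists_eq_sum_of_degree_lt hdeg hlc (k + 1) (Polynomial.X ^ k) (hX k)
  -- Since `p 0 = 1`, integrating the expansion of `X ^ k` isolates its `p 0` coefficient, which
  -- does not depend on `N`.
  have hmom : ∀ k N, k ≤ N → ∫ ξ, ξ ^ k ∂(ν N : Measure ℝ) = c k 0 := by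
    intro k N hkN
    have h1 : ∀ ξ : ℝ, ξ ^ k = ∑ j ∈ Finset.range (k + 1), c k j * ((p j).eval ξ * (p 0).eval ξ) := by
      intro ξ
      have := congrArg (Polynomial.eval ξ) (hc k)
      simpa [Polynomial.eval_finsetSum, h0] using this
    simp_rw [h1]
    rw [integral_finsetSum]
    · simp only [integral_const_mul]
      rw [Finset.sum_congr rfl fun j hj => by
        rw [hνo N j (by have := Finset.mem_range.1 hj; omega) 0 (by omega)]]
      simp
    · intro j _
      have := hνi N (p j * p 0)
      simp only [Polynomial.eval_mul] at this
      exact this.const_mul _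
  -- The second moment is known to be `c 2 0` only from index 2 on; the shift makes the bound
  -- uniform.
  obtain ⟨μ, hμi, hμm⟩ := exists_measure_of_eventually_moments_eq (fun N => ν (N + 2))
    (fun k => c k 0) (c 2 0) (fun N k => hνm _ k) (fun N => (hmom 2 _ (by omega)).le) (fun k => by
      filter_upwards [eventually_ge_atTop k] with N hN using hmom k _ (by omega))
  have hμo : ∀ m n, ∫ ξ, (p m).eval ξ * (p n).eval ξ ∂(μ : Measure ℝ) = if m = n then 1 else 0 := by
    intro m n
    set N := max (max m n) (p m * p n).natDegree
    rw [← hνo N m (by omega) n (by omega)]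
    simp only [← Polynomial.eval_mul]
    rw [integral_eval_eq_sum hμi, integral_eval_eq_sum (hνm N)]
    refine Finset.sum_congr rfl fun k hk => ?_
    rw [hμm, hmom k N (by have := Finset.mem_range.1 hk; omega)]
  have hneg : Measurable (fun ξ : ℝ => -ξ) := measurable_neg
  have hmap : ∀ f : ℝ → ℝ, Continuous f →
      ∫ ξ, f ξ ∂((μ : Measure ℝ).map (fun ξ => -ξ)) = ∫ ξ, f (-ξ) ∂(μ : Measure ℝ) := fun f hf =>
    integral_map hneg.aemeasurable hf.aestronglyMeasurable
  have hmapi : ∀ k : ℕ, Integrable (fun ξ : ℝ => ξ ^ k) ((μ : Measure ℝ).map (fun ξ => -ξ)) := by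
    intro k
    rw [integrable_map_measure (by fun_prop) hneg.aemeasurable]
    have : (fun ξ : ℝ => ξ ^ k) ∘ (fun ξ => -ξ) = fun ξ : ℝ => (-1) ^ k * ξ ^ k := by
      ext ξ; simp [neg_pow ξ]
    rw [this]
    exact (hμi k).const_mul _
  have h2 : (2⁻¹ : ENNReal) ≠ ⊤ := by simp
  -- Averaging `μ` with its reflection forces symmetry. Orthonormality survives, since reflection
  -- multiplies the integral by `(-1) ^ (m + n)`: this is 1 when `m = n`, and otherwise the integral
  -- is zero.
  refine ⟨(2⁻¹ : ENNReal) • ((μ : Measure ℝ) + (μ : Measure ℝ).map (fun ξ => -ξ)), ?_, ?_, ?_, ?_⟩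
  · constructor
    rw [Measure.smul_apply, Measure.add_apply, Measure.map_apply hneg MeasurableSet.univ]
    simp [one_add_one_eq_two, ENNReal.inv_mul_cancel]
  · exact fun k => ((hμi k).add_measure (hmapi k)).smul_measure h2
  · refine ⟨hdeg, hlc, fun m n => ?_⟩
    have hi1 := integrable_eval_of_moments hμi (p m * p n)
    have hi2 := integrable_eval_of_moments hmapi (p m * p n)
    simp only [Polynomial.eval_mul] at hi1 hi2
    rw [integral_smul_measure, integral_add_measure hi1 hi2, hmap _ (by fun_prop)]
    simp only [hp.eval_neg hb h0]
    have : ∀ ξ, (-1) ^ m * (p m).eval ξ * ((-1) ^ n * (p n).eval ξ) =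
        (-1) ^ (m + n) * ((p m).eval ξ * (p n).eval ξ) := fun ξ => by ring
    simp only [this, integral_const_mul, hμo]
    split_ifs with h
    · subst h
      rw [← two_mul, pow_mul]
      norm_num
    · simp
  · rw [Measure.map_smul, Measure.map_add _ _ hneg, Measure.map_map hneg hneg]
    have : ((fun ξ : ℝ => -ξ) ∘ fun ξ => -ξ) = id := by ext; simp
    rw [this, Measure.map_id, add_comm]

/-! ### The Fourier transform on `L²` -/

/-- A smooth compactly supported real function as a complex Schwartz function. -/
lemma exists_schwartzMap_eq {g : ℝ → ℂ} (hg : ContDiff ℝ (⊤ : ℕ∞) g) (hc : HasCompactSupport g) :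
    ∃ ψ : SchwartzMap ℝ ℂ, ∀ x, ψ x = g x :=
  ⟨hc.toSchwartzMap hg, fun _ => rfl⟩

/-- The multiplication formula for the inverse Fourier transform on `L²`. -/
lemma integral_schwartz_mul_fourierInv (ψ : SchwartzMap ℝ ℂ) (u : Lp ℂ 2 (volume : Measure ℝ)) :
    ∫ x, ψ x * (𝓕⁻ u : Lp ℂ 2 (volume : Measure ℝ)) x = ∫ x, (𝓕⁻ (ψ : ℝ → ℂ)) x * u x := by
  have h := congrArg (fun T : TemperedDistribution ℝ ℂ => T ψ)
    (Lp.fourierInv_toTemperedDistribution_eq u)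
  simp only [TemperedDistribution.fourierInv_apply, Lp.toTemperedDistribution_apply,
    smul_eq_mul, SchwartzMap.fourierInv_coe] at h
  exact h.symm

lemma integral_schwartz_mul_fourier (ψ : SchwartzMap ℝ ℂ) (u : Lp ℂ 2 (volume : Measure ℝ)) :
    ∫ x, ψ x * (𝓕 u : Lp ℂ 2 (volume : Measure ℝ)) x = ∫ x, (𝓕 (ψ : ℝ → ℂ)) x * u x := by
  have h := congrArg (fun T : TemperedDistribution ℝ ℂ => T ψ)
    (Lp.fourier_toTemperedDistribution_eq u)
  simp only [TemperedDistribution.fourier_apply, Lp.toTemperedDistribution_apply,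
    smul_eq_mul, SchwartzMap.fourier_coe] at h
  exact h.symm

/-- Two locally integrable functions with the same integrals against Schwartz functions agree
almost everywhere. -/
lemma ae_eq_of_integral_smooth_mul_eq {f f' : ℝ → ℂ} (hf : LocallyIntegrable f)
    (hf' : LocallyIntegrable f')
    (h : ∀ g : ℝ → ℂ, ContDiff ℝ (⊤ : ℕ∞) g → HasCompactSupport g →
      ∫ x, g x * f x = ∫ x, g x * f' x) : f =ᵐ[volume] f' := by
  refine ae_eq_of_integral_contDiff_smul_eq hf hf' fun g hg hc => ?_
  have := h (fun x => (g x : ℂ)) (Complex.ofRealCLM.contDiff.comp hg)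
    (hc.comp_left (g := fun y : ℝ => (y : ℂ)) (by simp))
  simpa [Complex.real_smul] using this

lemma continuous_fourierInv {h : ℝ → ℂ} (h1 : Integrable h) : Continuous (𝓕⁻ h) :=
  VectorFourier.fourierIntegral_continuous Real.continuous_fourierChar
    (by simp only [LinearMap.neg_apply, innerₗ_apply_apply]; fun_prop) h1

/-- On `L¹ ∩ L²` the inverse Fourier transform of `L²` is given by the integral. -/
theorem coeFn_fourierInv_toLp {h : ℝ → ℂ} (h1 : Integrable h) (h2 : MemLp h 2 volume) :
    (𝓕⁻ (h2.toLp h) : Lp ℂ 2 (volume : Measure ℝ)) =ᵐ[volume] 𝓕⁻ h := by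
  refine ae_eq_of_integral_smooth_mul_eq ((Lp.memLp _).locallyIntegrable (by norm_num))
    (continuous_fourierInv h1).locallyIntegrable fun g hg hc => ?_
  obtain ⟨ψ, hψ⟩ := exists_schwartzMap_eq hg hc
  simp only [← hψ]
  rw [integral_schwartz_mul_fourierInv]
  have h3 : ∫ x, (𝓕⁻ (ψ : ℝ → ℂ)) x * (h2.toLp h) x = ∫ x, (𝓕⁻ (ψ : ℝ → ℂ)) x * h x := by
    refine integral_congr_ae ?_
    filter_upwards [h2.coeFn_toLp] with x hx
    rw [hx]
  rw [h3]
  -- Fubini's multiplication formula; the sign in `-innerₗ ℝ` selects the inverse transform.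
  have h4 := VectorFourier.integral_fourierIntegral_smul_eq_flip (L := -innerₗ ℝ)
    (μ := (volume : Measure ℝ)) (ν := (volume : Measure ℝ)) (f := ψ) (g := h)
    Real.continuous_fourierChar
    (by simp only [LinearMap.neg_apply, innerₗ_apply_apply]; fun_prop) ψ.integrable h1
  have h5 : (-innerₗ ℝ).flip = -innerₗ ℝ := by
    ext; simp
  rw [h5] at h4
  exact h4

lemma hasDerivAt_fourier_of_hasCompactSupport {g : ℝ → ℂ} (hg : Continuous g)
    (hc : HasCompactSupport g) (x : ℝ) :
    HasDerivAt (𝓕 g) (𝓕 (fun x : ℝ => (-2 * Real.pi * Complex.I * x : ℂ) * g x) x) x := by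
  have h1 : Integrable g := hg.integrable_of_hasCompactSupport hc
  have h2 : Integrable fun x : ℝ => x • g x :=
    (continuous_id.smul hg).integrable_of_hasCompactSupport hc.smul_left
  exact Real.hasDerivAt_fourier h1 h2 x

/-- The `L²` Fourier transform turns differentiation into multiplication. -/
theorem coeFn_fourier_toLp_deriv {f f' : ℝ → ℂ} (hf : MemLp f 2 volume) (hf' : MemLp f' 2 volume)
    (hd : ∀ x, HasDerivAt f (f' x) x) :
    (𝓕 (hf'.toLp f') : Lp ℂ 2 (volume : Measure ℝ)) =ᵐ[volume]
      fun ξ => (2 * Real.pi * Complex.I * ξ) * (𝓕 (hf.toLp f) : Lp ℂ 2 (volume : Measure ℝ)) ξ := by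
  set G : Lp ℂ 2 (volume : Measure ℝ) := 𝓕 (hf.toLp f)
  have hG : LocallyIntegrable (G : ℝ → ℂ) := (Lp.memLp G).locallyIntegrable (by norm_num)
  refine ae_eq_of_integral_smooth_mul_eq ((Lp.memLp _).locallyIntegrable (by norm_num))
    ?_ fun g hg hc => ?_
  · exact hG.continuous_smul (g := fun ξ : ℝ => (2 * Real.pi * Complex.I * ξ : ℂ)) (by fun_prop)
  · obtain ⟨ψ, hψ⟩ := exists_schwartzMap_eq hg hc
    have hc2 : HasCompactSupport fun x : ℝ => (-2 * Real.pi * Complex.I * x : ℂ) * g x :=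
      hc.mul_left
    have hg2 : ContDiff ℝ (⊤ : ℕ∞) fun x : ℝ => (-2 * Real.pi * Complex.I * x : ℂ) * g x :=
      (contDiff_const.mul Complex.ofRealCLM.contDiff).mul hg
    obtain ⟨ψ₂, hψ₂⟩ := exists_schwartzMap_eq hg2 hc2
    have e1 := integral_schwartz_mul_fourier ψ (hf'.toLp f')
    have e2 := integral_schwartz_mul_fourier ψ₂ (hf.toLp f)
    have e3 : ∫ x, (𝓕 (ψ : ℝ → ℂ)) x * (hf'.toLp f') x = ∫ x, (𝓕 (ψ : ℝ → ℂ)) x * f' x := by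
      refine integral_congr_ae ?_
      filter_upwards [hf'.coeFn_toLp] with x hx
      rw [hx]
    have e4 : ∫ x, (𝓕 (ψ₂ : ℝ → ℂ)) x * (hf.toLp f) x = ∫ x, (𝓕 (ψ₂ : ℝ → ℂ)) x * f x := by
      refine integral_congr_ae ?_
      filter_upwards [hf.coeFn_toLp] with x hx
      rw [hx]
    have hdF : ∀ x, HasDerivAt (𝓕 (ψ : ℝ → ℂ)) (𝓕 (ψ₂ : ℝ → ℂ) x) x := by
      have h1 : (ψ : ℝ → ℂ) = g := funext hψ
      have h2 : (ψ₂ : ℝ → ℂ) = fun x : ℝ => (-2 * Real.pi * Complex.I * x : ℂ) * g x := funext hψ₂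
      rw [h1, h2]
      exact hasDerivAt_fourier_of_hasCompactSupport hg.continuous hc
    have m1 : MemLp (𝓕 (ψ : ℝ → ℂ)) 2 volume := by
      rw [← SchwartzMap.fourier_coe]; exact SchwartzMap.memLp _ 2 volume
    have m2 : MemLp (𝓕 (ψ₂ : ℝ → ℂ)) 2 volume := by
      rw [← SchwartzMap.fourier_coe]; exact SchwartzMap.memLp _ 2 volume
    -- Integration by parts has no boundary term, because all the products are integrable as
    -- products of `L²` functions.
    have e5 := integral_mul_deriv_eq_deriv_mul_of_integrable (fun x _ => hdF x)
      (fun x _ => hd x) (m1.integrable_mul hf') (m2.integrable_mul hf) (m1.integrable_mul hf)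
    simp only [← hψ]
    rw [e1, e3, e5, ← e4, ← e2, ← integral_neg]
    refine integral_congr_ae (ae_of_all _ fun x => ?_)
    simp only [hψ, hψ₂]
    ring

/-! ### Superalgebraic decay -/

/-- Some tail has norm below 1, hence finite, and off that tail the factor `ξ ^ n` is bounded by
`|R| ^ n`. -/
lemma HasSuperalgebraicDecay.memLp_pow_mul {g : ℝ → ℂ} (hd : HasSuperalgebraicDecay g)
    (hg : MemLp g 2 volume) (n : ℕ) : MemLp (fun ξ : ℝ => (ξ : ℂ) ^ n * g ξ) 2 volume := by
  have hmeas : AEStronglyMeasurable (fun ξ : ℝ => (ξ : ℂ) ^ n * g ξ) volume :=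
    AEStronglyMeasurable.mul (by fun_prop) hg.1
  obtain ⟨R, hR⟩ := ((hd n).eventually (gt_mem_nhds (zero_lt_one (α := ENNReal)))).exists
  set s : Set ℝ := {ξ : ℝ | R < |ξ|}
  have hs : MeasurableSet s := measurableSet_lt measurable_const (by fun_prop)
  have h1 : MemLp (s.indicator fun ξ : ℝ => (ξ : ℂ) ^ n * g ξ) 2 volume :=
    (memLp_indicator_iff_restrict hs).2 ⟨hmeas.restrict, hR.trans ENNReal.one_lt_top⟩
  have h2 : MemLp (sᶜ.indicator fun ξ : ℝ => (ξ : ℂ) ^ n * g ξ) 2 volume := by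
    refine hg.of_le_mul (c := |R| ^ n) (hmeas.indicator hs.compl) (ae_of_all _ fun ξ => ?_)
    by_cases hξ : ξ ∈ s
    · simp only [Set.indicator_of_notMem (Set.notMem_compl_iff.2 hξ), norm_zero]
      positivity
    · rw [Set.indicator_of_mem (Set.mem_compl hξ), norm_mul, norm_pow, Complex.norm_real,
        Real.norm_eq_abs]
      have : |ξ| ≤ |R| := (not_lt.1 hξ).trans (le_abs_self R)
      gcongr
  have := h1.add h2
  rwa [Set.indicator_self_add_compl] at this

lemma hasSuperalgebraicDecay_of_memLp {g : ℝ → ℂ}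
    (h : ∀ n : ℕ, MemLp (fun ξ : ℝ => (ξ : ℂ) ^ n * g ξ) 2 volume) : HasSuperalgebraicDecay g := by
  intro n
  set f := fun ξ : ℝ => (ξ : ℂ) ^ n * g ξ with hf
  have hs : ∀ R : ℝ, MeasurableSet {ξ : ℝ | R < |ξ|} := fun R =>
    measurableSet_lt measurable_const (by fun_prop)
  obtain ⟨f₀, hf₀, hff₀⟩ := (h n).1
  have hfin : ∫⁻ ξ, ‖f₀ ξ‖ₑ ^ (2 : ℝ) ≠ ⊤ := by
    have := (eLpNorm_lt_top_iff_lintegral_rpow_enorm_lt_top (by norm_num) (by norm_num)).1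
      ((memLp_congr_ae hff₀).1 (h n)).2
    simpa using this.ne
  have hm : Measurable fun ξ => ‖f₀ ξ‖ₑ ^ (2 : ℝ) := hf₀.measurable.enorm.pow_const _
  have key : Tendsto (fun R : ℝ => ∫⁻ ξ in {ξ : ℝ | R < |ξ|}, ‖f₀ ξ‖ₑ ^ (2 : ℝ)) atTop (𝓝 0) := by
    have := tendsto_lintegral_filter_of_dominated_convergence (l := atTop) (μ := (volume : Measure ℝ))
      (F := fun R : ℝ => {ξ : ℝ | R < |ξ|}.indicator fun ξ => ‖f₀ ξ‖ₑ ^ (2 : ℝ)) (f := 0)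
      (fun ξ => ‖f₀ ξ‖ₑ ^ (2 : ℝ)) (Eventually.of_forall fun R => hm.indicator (hs R))
      (Eventually.of_forall fun R => ae_of_all _ fun ξ => Set.indicator_le_self _ _ _) hfin
      (ae_of_all _ fun ξ => by
        refine tendsto_const_nhds.congr' ?_
        filter_upwards [eventually_ge_atTop |ξ|] with R hR
        rw [Set.indicator_of_notMem (by simpa using hR)]
        rfl)
    simpa [lintegral_indicator (hs _)] using this
  have h2 : Tendsto (fun R : ℝ => (∫⁻ ξ in {ξ : ℝ | R < |ξ|}, ‖f₀ ξ‖ₑ ^ (2 : ℝ)) ^ (1 / 2 : ℝ))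
      atTop (𝓝 0) := by
    have := (ENNReal.continuous_rpow_const (y := (1 / 2 : ℝ))).tendsto 0 |>.comp key
    simpa [Function.comp_def, ENNReal.zero_rpow_of_pos] using this
  refine h2.congr fun R => ?_
  rw [eLpNorm_congr_ae (ae_restrict_of_ae hff₀),
    eLpNorm_eq_lintegral_rpow_enorm_toReal (by norm_num) (by norm_num)]
  simp

/-- A square integrable function whose product with `ξ²` is square integrable is integrable. -/
lemma integrable_of_memLp_sq_mul {f : ℝ → ℂ} (h0 : MemLp f 2 volume)
    (h2 : MemLp (fun ξ : ℝ => (ξ : ℂ) ^ 2 * f ξ) 2 volume) : Integrable f := by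
  -- Cauchy–Schwarz against this weight: `f` is the weight times `(1 + ξ ^ 2) * f`, both in `L²`.
  have hw : MemLp (fun ξ : ℝ => (((1 + ξ ^ 2)⁻¹ : ℝ) : ℂ)) 2 volume := by
    have hmeas : AEStronglyMeasurable (fun ξ : ℝ => (1 + ξ ^ 2)⁻¹) volume :=
      integrable_inv_one_add_sq.1
    refine MemLp.ofReal ((memLp_two_iff_integrable_sq hmeas).2 ?_)
    refine integrable_inv_one_add_sq.mono' (hmeas.pow 2) (ae_of_all _ fun ξ => ?_)
    have h1 : (1 + ξ ^ 2)⁻¹ ≤ 1 := inv_le_one_of_one_le₀ (by nlinarith [sq_nonneg ξ])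
    have h2 : 0 ≤ (1 + ξ ^ 2)⁻¹ := by positivity
    rw [Real.norm_eq_abs, abs_of_nonneg (by positivity)]
    nlinarith
  refine (hw.integrable_mul (h0.add h2)).congr (ae_of_all _ fun ξ => ?_)
  have : (1 + (ξ : ℂ) ^ 2) ≠ 0 := by
    have : (1 + ξ ^ 2 : ℝ) ≠ 0 := by positivity
    exact_mod_cast this
  simp only [Pi.mul_apply, Pi.add_apply]
  push_cast
  field_simp

lemma memLp_eval_mul {g : ℝ → ℂ} (h : ∀ n : ℕ, MemLp (fun ξ : ℝ => (ξ : ℂ) ^ n * g ξ) 2 volume)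
    (q : Polynomial ℝ) : MemLp (fun ξ : ℝ => ((q.eval ξ : ℝ) : ℂ) * g ξ) 2 volume := by
  simp only [Polynomial.eval_eq_sum_range]
  push_cast
  simp only [Finset.sum_mul]
  exact memLp_finsetSum _ fun k _ => by simpa only [mul_assoc] using (h k).const_mul _

lemma integrable_eval_mul {g : ℝ → ℂ}
    (h : ∀ n : ℕ, MemLp (fun ξ : ℝ => (ξ : ℂ) ^ n * g ξ) 2 volume)
    (q : Polynomial ℝ) : Integrable (fun ξ : ℝ => ((q.eval ξ : ℝ) : ℂ) * g ξ) := by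
  refine integrable_of_memLp_sq_mul (memLp_eval_mul h q) ?_
  refine (memLp_congr_ae (ae_of_all _ fun ξ => ?_)).1 (memLp_eval_mul h (Polynomial.X ^ 2 * q))
  rw [Polynomial.eval_mul, Polynomial.eval_pow, Polynomial.eval_X]
  push_cast
  ring

/-! ### Fourier integrals without the factor 2π in the exponent -/

/-- The integral `∫ exp (i x ξ) h(ξ) dξ`. -/
noncomputable def expIntegral (h : ℝ → ℂ) (x : ℝ) : ℂ :=
  ∫ ξ : ℝ, Complex.exp (Complex.I * (x : ℂ) * (ξ : ℂ)) * h ξ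

lemma expIntegral_two_pi_mul (h : ℝ → ℂ) (x : ℝ) :
    expIntegral h (2 * Real.pi * x) = 𝓕⁻ h x := by
  rw [Real.fourierInv_eq', expIntegral]
  refine integral_congr_ae (ae_of_all _ fun ξ => ?_)
  simp only [smul_eq_mul, RCLike.inner_apply, conj_trivial]
  congr 2
  push_cast
  ring

lemma expIntegral_eq_fourierInv (h : ℝ → ℂ) (x : ℝ) :
    expIntegral h x = 𝓕⁻ h ((2 * Real.pi)⁻¹ * x) := by
  rw [← expIntegral_two_pi_mul]
  congr 1
  field_simp

lemma MeasureTheory.MemLp.comp_mul_left {f : ℝ → ℂ} (hf : MemLp f 2 volume) {a : ℝ} (ha : a ≠ 0) :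
    MemLp (fun x => f (a * x)) 2 volume := by
  refine MemLp.comp_of_map (f := fun x => a * x) ?_ (by fun_prop)
  rw [Real.map_volume_mul_left ha]
  exact hf.smul_measure (by simp)

theorem memLp_expIntegral {h : ℝ → ℂ} (h1 : Integrable h) (h2 : MemLp h 2 volume) :
    MemLp (expIntegral h) 2 volume := by
  have h3 : MemLp (𝓕⁻ h) 2 volume :=
    (memLp_congr_ae (coeFn_fourierInv_toLp h1 h2)).1 (Lp.memLp _)
  rw [show expIntegral h = fun x => 𝓕⁻ h ((2 * Real.pi)⁻¹ * x) from
    funext (expIntegral_eq_fourierInv h)]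
  exact h3.comp_mul_left (by positivity)

/-- After rescaling, this is injectivity of the inverse Fourier isometry of `L²`. -/
theorem ae_eq_of_expIntegral_eq {h k : ℝ → ℂ} (h1 : Integrable h) (h2 : MemLp h 2 volume)
    (k1 : Integrable k) (k2 : MemLp k 2 volume) (he : expIntegral h = expIntegral k) :
    h =ᵐ[volume] k := by
  have h3 : 𝓕⁻ h = 𝓕⁻ k := by
    ext x; rw [← expIntegral_two_pi_mul, ← expIntegral_two_pi_mul, he]
  have h4 : (𝓕⁻ (h2.toLp h) : Lp ℂ 2 (volume : Measure ℝ)) = 𝓕⁻ (k2.toLp k) := by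
    refine Lp.ext ((coeFn_fourierInv_toLp h1 h2).trans ?_)
    rw [h3]
    exact (coeFn_fourierInv_toLp k1 k2).symm
  have h5 : h2.toLp h = k2.toLp k := (Lp.fourierTransformₗᵢ ℝ ℂ).symm.injective h4
  exact (MemLp.toLp_eq_toLp_iff h2 k2).1 h5

lemma hasDerivAt_expIntegral {h : ℝ → ℂ} (h0 : Integrable h)
    (h1 : Integrable fun ξ : ℝ => (ξ : ℂ) * h ξ) (x : ℝ) :
    HasDerivAt (expIntegral h) (Complex.I * expIntegral (fun ξ => (ξ : ℂ) * h ξ) x) x := by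
  have hn : ∀ x ξ : ℝ, ‖Complex.exp (Complex.I * (x : ℂ) * (ξ : ℂ))‖ = 1 := by
    intro x ξ
    rw [Complex.norm_exp]; simp
  have hm : ∀ (k : ℝ → ℂ), Integrable k → ∀ x : ℝ, AEStronglyMeasurable
      (fun ξ : ℝ => Complex.exp (Complex.I * (x : ℂ) * (ξ : ℂ)) * k ξ) volume := fun k hk x =>
    AEStronglyMeasurable.mul (by fun_prop) hk.1
  have := (hasDerivAt_integral_of_dominated_loc_of_deriv_le (μ := (volume : Measure ℝ))
    (F := fun (x ξ : ℝ) => Complex.exp (Complex.I * (x : ℂ) * (ξ : ℂ)) * h ξ)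
    (F' := fun (x ξ : ℝ) => Complex.I *
      (Complex.exp (Complex.I * (x : ℂ) * (ξ : ℂ)) * ((ξ : ℂ) * h ξ)))
    (bound := fun ξ => ‖(ξ : ℂ) * h ξ‖) (x₀ := x) univ_mem
    (Eventually.of_forall fun y => hm h h0 y) (h0.mono (hm h h0 x) (ae_of_all _ fun ξ => by
      rw [norm_mul, hn, one_mul]))
    ((hm _ h1 x).const_mul _) (ae_of_all _ fun ξ y _ => by
      rw [norm_mul, norm_mul, hn, Complex.norm_I, one_mul, one_mul]) h1.norm
    (ae_of_all _ fun ξ y _ => by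
      have e1 : HasDerivAt (fun y : ℝ => Complex.I * (y : ℂ) * (ξ : ℂ)) (Complex.I * 1 * ξ) y :=
        ((Complex.ofRealCLM.hasDerivAt (x := y)).const_mul Complex.I).mul_const _
      refine (e1.cexp.mul_const (h ξ)).congr_deriv ?_
      ring)).2
  rw [integral_const_mul] at this
  exact this

lemma star_expIntegral (h : ℝ → ℂ) (x : ℝ) :
    (starRingEnd ℂ) (expIntegral h x) =
      expIntegral (fun ξ => (starRingEnd ℂ) (h (-ξ))) x := by
  rw [expIntegral, expIntegral, ← integral_conj,
    ← integral_neg_eq_self (fun ξ : ℝ => (starRingEnd ℂ)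
      (Complex.exp (Complex.I * (x : ℂ) * (ξ : ℂ)) * h ξ))]
  refine integral_congr_ae (ae_of_all _ fun ξ => ?_)
  simp only [map_mul, ← Complex.exp_conj, Complex.conj_I, Complex.conj_ofReal]
  congr 2
  push_cast
  ring

/-! ### The Fourier system of a polynomial sequence -/

/-- The functions `iⁿ / √(2π) ∫ exp (i x ξ) pₙ(ξ) g(ξ) dξ`. -/
noncomputable def fourierSystem (p : ℕ → Polynomial ℝ) (g : ℝ → ℂ) (n : ℕ) (x : ℝ) : ℂ :=
  Complex.I ^ n / ((Real.sqrt (2 * Real.pi) : ℝ) : ℂ) *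
    expIntegral (fun ξ => (((p n).eval ξ : ℝ) : ℂ) * g ξ) x

section

variable {g : ℝ → ℂ} {p : ℕ → Polynomial ℝ}

lemma memLp_fourierSystem (hg : ∀ n : ℕ, MemLp (fun ξ : ℝ => (ξ : ℂ) ^ n * g ξ) 2 volume)
    (n : ℕ) : MemLp (fourierSystem p g n) 2 volume :=
  (memLp_expIntegral (integrable_eval_mul hg (p n)) (memLp_eval_mul hg (p n))).const_mul _

lemma expIntegral_add_eval (hg : ∀ n : ℕ, MemLp (fun ξ : ℝ => (ξ : ℂ) ^ n * g ξ) 2 volume)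
    (q r : Polynomial ℝ) (a c : ℝ) (x : ℝ) :
    expIntegral (fun ξ => (((Polynomial.C a * q + Polynomial.C c * r).eval ξ : ℝ) : ℂ) * g ξ) x =
      a * expIntegral (fun ξ => ((q.eval ξ : ℝ) : ℂ) * g ξ) x +
      c * expIntegral (fun ξ => ((r.eval ξ : ℝ) : ℂ) * g ξ) x := by
  have hi : ∀ q : Polynomial ℝ, Integrable fun ξ : ℝ =>
      Complex.exp (Complex.I * (x : ℂ) * (ξ : ℂ)) * (((q.eval ξ : ℝ) : ℂ) * g ξ) := by
    intro q
    have := integrable_eval_mul hg q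
    refine this.mono (AEStronglyMeasurable.mul (by fun_prop) this.1) (ae_of_all _ fun ξ => ?_)
    rw [norm_mul, Complex.norm_exp]; simp
  simp only [expIntegral]
  rw [← integral_const_mul, ← integral_const_mul,
    ← integral_add ((hi q).const_mul _) ((hi r).const_mul _)]
  refine integral_congr_ae (ae_of_all _ fun ξ => ?_)
  simp only [Polynomial.eval_add, Polynomial.eval_mul, Polynomial.eval_C]
  push_cast
  ring

/-- Of the factor `iξ` brought down, `i` raises the phase to `I ^ (n + 1)` and `ξ` multiplies the
polynomial. Relative to the phase of index `n - 1` this leaves `I ^ 2 = -1`, the source of the skew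
sign. -/
lemma hasDerivAt_fourierSystem (hg : ∀ n : ℕ, MemLp (fun ξ : ℝ => (ξ : ℂ) ^ n * g ξ) 2 volume)
    (n : ℕ) (x : ℝ) : HasDerivAt (fourierSystem p g n)
      (Complex.I ^ (n + 1) / ((Real.sqrt (2 * Real.pi) : ℝ) : ℂ) *
        expIntegral (fun ξ => (((Polynomial.X * p n).eval ξ : ℝ) : ℂ) * g ξ) x) x := by
  have he : (fun ξ : ℝ => (((Polynomial.X * p n).eval ξ : ℝ) : ℂ) * g ξ) =
      fun ξ : ℝ => (ξ : ℂ) * ((((p n).eval ξ : ℝ) : ℂ) * g ξ) := by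
    ext ξ
    rw [Polynomial.eval_mul, Polynomial.eval_X, Complex.ofReal_mul, mul_assoc]
  have h1 := integrable_eval_mul hg (Polynomial.X * p n)
  rw [he] at h1 ⊢
  refine ((hasDerivAt_expIntegral (integrable_eval_mul hg (p n)) h1 x).const_mul
    (Complex.I ^ n / ((Real.sqrt (2 * Real.pi) : ℝ) : ℂ))).congr_deriv ?_
  ring

/-- A three-term recurrence for the polynomials gives the differential recurrence. -/
theorem SatisfiesThreeTermRecurrence.satisfiesSkewRecurrence {b : ℕ → ℝ}
    (hp : SatisfiesThreeTermRecurrence p b)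
    (hg : ∀ n : ℕ, MemLp (fun ξ : ℝ => (ξ : ℂ) ^ n * g ξ) 2 volume) :
    SatisfiesSkewRecurrence (fourierSystem p g) b := by
  constructor
  · intro x
    refine (hasDerivAt_fourierSystem hg 0 x).congr_deriv ?_
    have := expIntegral_add_eval hg (p 1) 0 (b 0) 0 x
    rw [mul_zero, add_zero] at this
    rw [hp.zero, this, fourierSystem]
    push_cast
    ring
  · intro n x
    refine (hasDerivAt_fourierSystem hg (n + 1) x).congr_deriv ?_
    rw [hp.succ, expIntegral_add_eval hg, fourierSystem, fourierSystem]
    linear_combination (Complex.I ^ n / ((Real.sqrt (2 * Real.pi) : ℝ) : ℂ) * b n *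
      expIntegral (fun ξ => (((p n).eval ξ : ℝ) : ℂ) * g ξ) x) * Complex.I_sq

lemma fourierSystem_im_eq_zero (hpar : ∀ n x, (p n).eval (-x) = (-1) ^ n * (p n).eval x)
    (hg : ∀ᵐ ξ : ℝ, (starRingEnd ℂ) (g (-ξ)) = g ξ) (n : ℕ) (x : ℝ) :
    (fourierSystem p g n x).im = 0 := by
  rw [← Complex.conj_eq_iff_im, fourierSystem, map_mul, star_expIntegral]
  have h1 : expIntegral (fun ξ => (starRingEnd ℂ) ((((p n).eval (-ξ) : ℝ) : ℂ) * g (-ξ))) x =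
      (-1) ^ n * expIntegral (fun ξ => (((p n).eval ξ : ℝ) : ℂ) * g ξ) x := by
    rw [expIntegral, expIntegral, ← integral_const_mul]
    refine integral_congr_ae ?_
    filter_upwards [hg] with ξ hξ
    rw [map_mul, Complex.conj_ofReal, hξ, hpar]
    push_cast
    ring
  rw [h1, map_div₀, map_pow, Complex.conj_I, Complex.conj_ofReal]
  have h2 : (-Complex.I) ^ n * (-1) ^ n = Complex.I ^ n := by
    rw [← mul_pow]; simp
  linear_combination (expIntegral (fun ξ => (((p n).eval ξ : ℝ) : ℂ) * g ξ) x /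
    ((Real.sqrt (2 * Real.pi) : ℝ) : ℂ)) * h2

end

/-! ### From the recurrence to the representation -/

/-- Solutions of the differential recurrence are determined by their first function. -/
lemma SatisfiesSkewRecurrence.unique {φ ψ : ℕ → ℝ → ℂ} {b : ℕ → ℝ} (hb : ∀ n, 0 < b n)
    (hφ : SatisfiesSkewRecurrence φ b) (hψ : SatisfiesSkewRecurrence ψ b) (h0 : φ 0 = ψ 0)
    (n : ℕ) : φ n = ψ n := by
  have hb' : ∀ n, (b n : ℂ) ≠ 0 := fun n => by exact_mod_cast (hb n).ne'
  induction n using Nat.strong_induction_on with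
  | _ n ih =>
    match n with
    | 0 => exact h0
    | 1 =>
      ext x
      have h1 := hφ.zero x
      rw [h0] at h1
      exact mul_left_cancel₀ (hb' 0) (h1.unique (hψ.zero x))
    | n + 2 =>
      ext x
      have h1 := hφ.succ n x
      rw [ih (n + 1) (by omega), ih n (by omega)] at h1
      exact mul_left_cancel₀ (hb' (n + 1)) (add_left_cancel (h1.unique (hψ.succ n x)))

/-- The Fourier transforms of square integrable solutions of the differential recurrence decay
faster than every power. -/
theorem SatisfiesSkewRecurrence.memLp_pow_mul_fourier {φ : ℕ → ℝ → ℂ} {b : ℕ → ℝ}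
    (hφ : SatisfiesSkewRecurrence φ b) (h2 : ∀ n, MemLp (φ n) 2 volume) (k n : ℕ) :
    MemLp (fun ξ : ℝ => (ξ : ℂ) ^ k *
      (𝓕 ((h2 n).toLp (φ n)) : Lp ℂ 2 (volume : Measure ℝ)) ξ) 2 volume := by
  induction k generalizing n with
  | zero => simpa using Lp.memLp (𝓕 ((h2 n).toLp (φ n)) : Lp ℂ 2 (volume : Measure ℝ))
  | succ k ih =>
    -- One differentiation gains one power of `ξ`. The general coefficients cover both forms of the
    -- recurrence; for `n = 0` the first one is zero.
    have hstep : ∀ (m j : ℕ) (a c : ℂ),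
        (∀ x, HasDerivAt (φ n) (a * φ m x + c * φ j x) x) →
        MemLp (fun ξ : ℝ => (ξ : ℂ) ^ (k + 1) *
          (𝓕 ((h2 n).toLp (φ n)) : Lp ℂ 2 (volume : Measure ℝ)) ξ) 2 volume := by
      intro m j a c hd
      have hf' : MemLp (a • φ m + c • φ j) 2 volume :=
        ((h2 m).const_smul a).add ((h2 j).const_smul c)
      have h3 := coeFn_fourier_toLp_deriv (h2 n) hf' hd
      have h4 : (𝓕 (hf'.toLp _) : Lp ℂ 2 (volume : Measure ℝ)) =
          a • 𝓕 ((h2 m).toLp (φ m)) + c • 𝓕 ((h2 j).toLp (φ j)) := by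
        rw [MemLp.toLp_add ((h2 m).const_smul a) ((h2 j).const_smul c), MemLp.toLp_const_smul,
          MemLp.toLp_const_smul, FourierTransform.fourier_add, FourierTransform.fourier_smul,
          FourierTransform.fourier_smul]
      rw [h4] at h3
      have h5 := (((ih m).const_mul a).add ((ih j).const_mul c)).const_mul
        (2 * Real.pi * Complex.I)⁻¹
      refine (memLp_congr_ae ?_).1 h5
      filter_upwards [h3, Lp.coeFn_add (a • 𝓕 ((h2 m).toLp (φ m)))
        (c • 𝓕 ((h2 j).toLp (φ j))), Lp.coeFn_smul a (𝓕 ((h2 m).toLp (φ m))),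
        Lp.coeFn_smul c (𝓕 ((h2 j).toLp (φ j)))] with ξ e1 e2 e3 e4
      rw [e2, Pi.add_apply, e3, e4] at e1
      simp only [Pi.smul_apply, smul_eq_mul] at e1
      have hpi : (2 * Real.pi * Complex.I : ℂ) ≠ 0 := Complex.two_pi_I_ne_zero
      simp only [Pi.add_apply]
      rw [inv_mul_eq_iff_eq_mul₀ hpi]
      linear_combination (ξ : ℂ) ^ k * e1
    cases n with
    | zero =>
      refine hstep 0 1 0 (b 0) fun x => ?_
      simpa using hφ.zero x
    | succ n => exact hstep n (n + 2) _ _ (hφ.succ n)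

/-- A continuous square integrable function whose Fourier transform decays fast is given by the
Fourier integral of a rapidly decaying function. -/
theorem exists_eq_expIntegral {f : ℝ → ℂ} (hf : MemLp f 2 volume) (hc : Continuous f)
    (hG : ∀ k : ℕ, MemLp (fun ξ : ℝ => (ξ : ℂ) ^ k *
      (𝓕 (hf.toLp f) : Lp ℂ 2 (volume : Measure ℝ)) ξ) 2 volume) :
    ∃ g : ℝ → ℂ, (∀ k : ℕ, MemLp (fun ξ : ℝ => (ξ : ℂ) ^ k * g ξ) 2 volume) ∧
      ∀ x, f x = 1 / ((Real.sqrt (2 * Real.pi) : ℝ) : ℂ) * expIntegral g x := by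
  set G : Lp ℂ 2 (volume : Measure ℝ) := 𝓕 (hf.toLp f) with hGdef
  have hG2 : MemLp G 2 volume := Lp.memLp G
  have hG1 : Integrable G := integrable_of_memLp_sq_mul hG2 (hG 2)
  -- Fourier inversion holds almost everywhere, and continuity of both sides makes it hold
  -- everywhere.
  have hinv : f = 𝓕⁻ (G : ℝ → ℂ) := by
    rw [← Continuous.ae_eq_iff_eq volume hc (continuous_fourierInv hG1)]
    refine hf.coeFn_toLp.symm.trans (Filter.EventuallyEq.trans ?_ (coeFn_fourierInv_toLp hG1 hG2))
    rw [Lp.toLp_coeFn, hGdef, FourierTransform.fourierInv_fourier_eq]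
  have hs : ((Real.sqrt (2 * Real.pi) : ℝ) : ℂ) ^ 2 = 2 * Real.pi := by
    rw [← Complex.ofReal_pow, Real.sq_sqrt (by positivity)]; push_cast; ring
  have hs0 : ((Real.sqrt (2 * Real.pi) : ℝ) : ℂ) ≠ 0 := by
    have : Real.sqrt (2 * Real.pi) ≠ 0 := by positivity
    exact_mod_cast this
  have hpi : (2 * Real.pi : ℝ) ≠ 0 := by positivity
  -- The dilation by `2π` and the factor `(2π)^(-1/2)` convert Mathlib's normalisation to the one in
  -- the statement.
  refine ⟨fun ξ => ((Real.sqrt (2 * Real.pi) : ℝ) : ℂ)⁻¹ * G ((2 * Real.pi)⁻¹ * ξ), fun k => ?_,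
    fun x => ?_⟩
  · have h1 := (((hG k).comp_mul_left (inv_ne_zero hpi)).const_mul
      ((2 * Real.pi : ℂ) ^ k)).const_mul ((Real.sqrt (2 * Real.pi) : ℝ) : ℂ)⁻¹
    refine (memLp_congr_ae (ae_of_all _ fun ξ => ?_)).1 h1
    have hpi' : (2 * Real.pi : ℂ) ≠ 0 := by exact_mod_cast hpi
    have : (2 * Real.pi : ℂ) ^ k * (((2 * Real.pi)⁻¹ * ξ : ℝ) : ℂ) ^ k = (ξ : ℂ) ^ k := by
      rw [← mul_pow]
      push_cast
      rw [mul_inv_cancel_left₀ hpi']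
    simp only
    rw [← this]
    ring
  · have h1 : expIntegral (fun ξ => ((Real.sqrt (2 * Real.pi) : ℝ) : ℂ)⁻¹ *
        G ((2 * Real.pi)⁻¹ * ξ)) x =
        ((Real.sqrt (2 * Real.pi) : ℝ) : ℂ)⁻¹ * ((2 * Real.pi : ℂ) *
          expIntegral G (2 * Real.pi * x)) := by
      have h2 := Measure.integral_comp_mul_left (fun ξ : ℝ =>
        Complex.exp (Complex.I * ((2 * Real.pi * x : ℝ) : ℂ) * (ξ : ℂ)) * G ξ) (2 * Real.pi)⁻¹
      rw [inv_inv, abs_of_pos (by positivity), Complex.real_smul] at h2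
      push_cast at h2
      simp only [expIntegral]
      push_cast
      rw [← h2, ← integral_const_mul]
      refine integral_congr_ae (ae_of_all _ fun ξ => ?_)
      have hpi' : (Real.pi : ℂ) ≠ 0 := by exact_mod_cast Real.pi_ne_zero
      simp only
      rw [show Complex.I * (2 * Real.pi * x : ℂ) * ((2 * Real.pi : ℂ)⁻¹ * ξ) =
        Complex.I * x * ξ by field_simp]
      ring
    rw [h1, hinv, expIntegral_two_pi_mul, ← hs]
    field_simp

lemma exp_I_mul_mod_four (n : ℕ) :
    Complex.exp (Complex.I * (((n % 4 : ℕ) * (Real.pi / 2) : ℝ) : ℂ)) = Complex.I ^ n := by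
  rw [Complex.I_pow_eq_pow_mod n]
  have h : Complex.exp (Real.pi / 2 * Complex.I) = Complex.I := Complex.exp_pi_div_two_mul_I
  conv_rhs => rw [← h]
  rw [← Complex.exp_nat_mul]
  congr 1
  push_cast
  ring

lemma star_eq_iff_re_im (z w : ℂ) : (starRingEnd ℂ) z = w ↔ z.re = w.re ∧ z.im = -w.im := by
  rw [Complex.ext_iff, Complex.conj_re, Complex.conj_im, neg_eq_iff_eq_neg]

theorem corollary1 (φ : ℕ → ℝ → ℂ) :
    ((∀ n, MemLp (φ n) 2 volume) ∧ (∀ n x, (φ n x).im = 0) ∧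
      ∃ b : ℕ → ℝ, (∀ n, 0 < b n) ∧ SatisfiesSkewRecurrence φ b) ↔
    ∃ (μ : Measure ℝ) (p : ℕ → Polynomial ℝ) (g : ℝ → ℂ) (θ : ℕ → ℝ),
      IsFourierRepresentation φ μ p g θ ∧
      μ.map (fun ξ : ℝ => -ξ) = μ ∧
      (∀ᵐ ξ : ℝ, (g (-ξ)).re = (g ξ).re ∧ (g (-ξ)).im = -(g ξ).im) ∧
      ∀ n, Complex.exp (Complex.I * (θ n : ℂ)) = Complex.I ^ n := by
  constructor
  · rintro ⟨h2, hreal, b, hb, hφ⟩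
    obtain ⟨g, hg, hφg⟩ := exists_eq_expIntegral (h2 0)
      (continuous_iff_continuousAt.2 fun x => (hφ.zero x).continuousAt)
      (fun k => hφ.memLp_pow_mul_fourier h2 k 0)
    set p := recurrencePoly b
    have hp : SatisfiesThreeTermRecurrence p b := recurrencePoly_satisfies hb
    have hp0 : p 0 = 1 := by simp [p, recurrencePoly]
    obtain ⟨μ, hμ, hm, hpo, hs⟩ := exists_symmetric_orthonormal_measure hb hp hp0
      (fun n => (recurrencePoly_degree hb n).1) (fun n => (recurrencePoly_degree hb n).2)
    have hg2 : MemLp g 2 volume := by simpa using hg 0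
    have hg1 : Integrable g := integrable_of_memLp_sq_mul hg2 (hg 2)
    have heq : ∀ n, φ n = fourierSystem p g n :=
      hφ.unique hb (hp.satisfiesSkewRecurrence hg) (by
        ext x
        rw [hφg, fourierSystem]
        simp [hp0])
    -- Reducing `n` modulo 4 keeps the phase in `[0, 2π)` without changing `I ^ n`.
    refine ⟨μ, p, g, fun n => (n % 4 : ℕ) * (Real.pi / 2), ⟨hμ, hm,
      hpo.hasInfinitelyManyPointsOfIncrease hm, hpo, hg2, hasSuperalgebraicDecay_of_memLp hg,
      fun n => ⟨by positivity, ?_⟩, fun n x => ?_⟩, hs, ?_, exp_I_mul_mod_four⟩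
    · have h4 : ((n % 4 : ℕ) : ℝ) < 4 := by exact_mod_cast Nat.mod_lt n (by norm_num)
      nlinarith [Real.pi_pos]
    · rw [heq, exp_I_mul_mod_four, fourierSystem, expIntegral]
      simp only [mul_assoc]
    -- Since `φ 0` is real, `g` and its conjugate reflection have the same Fourier integral, hence
    -- agree almost everywhere.
    · have hsymm : expIntegral (fun ξ => (starRingEnd ℂ) (g (-ξ))) = expIntegral g := by
        ext x
        have h3 := Complex.conj_eq_iff_im.2 (hreal 0 x)
        have hs0 : ((Real.sqrt (2 * Real.pi) : ℝ) : ℂ) ≠ 0 := by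
          have : Real.sqrt (2 * Real.pi) ≠ 0 := by positivity
          exact_mod_cast this
        rw [hφg, map_mul, map_div₀, map_one, Complex.conj_ofReal, star_expIntegral] at h3
        exact mul_left_cancel₀ (one_div_ne_zero hs0) h3
      have hmp : MeasurePreserving (fun ξ : ℝ => -ξ) volume volume :=
        Measure.measurePreserving_neg volume
      have k2 : MemLp (fun ξ => (starRingEnd ℂ) (g (-ξ))) 2 volume :=
        (hg2.comp_measurePreserving hmp).star
      have k1 : Integrable (fun ξ => (starRingEnd ℂ) (g (-ξ))) :=
        memLp_one_iff_integrable.1 (memLp_one_iff_integrable.2 hg1.comp_neg).star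
      filter_upwards [ae_eq_of_expIntegral_eq k1 k2 hg1 hg2 hsymm] with ξ hξ
      exact (star_eq_iff_re_im _ _).1 hξ
  · rintro ⟨μ, p, g, θ, hrep, hs, hsymm, hθ⟩
    have hg := hrep.decay.memLp_pow_mul hrep.memLp
    obtain ⟨b, hb, hp⟩ :=
      hrep.orthonormal.exists_satisfiesThreeTermRecurrence hrep.moments_finite hs
    have heq : φ = fourierSystem p g := by
      ext n x
      rw [hrep.eq_integral, hθ, fourierSystem, expIntegral]
      simp only [mul_assoc]
    rw [heq]
    refine ⟨memLp_fourierSystem hg, fourierSystem_im_eq_zero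
      (hrep.orthonormal.eval_neg hrep.moments_finite hs) ?_, b, hb, hp.satisfiesSkewRecurrence hg⟩
    filter_upwards [hsymm] with ξ hξ
    exact (star_eq_iff_re_im _ _).2 hξ
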